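/- Let $f=f_1-f_2$ and $h=h_1-h_2$ with $f_1,f_2,h_1,h_2:\mathbb R^d\to\mathbb R$ convex, and let $F=f+h$. Assume: * $f$ is twice differentiable and bounded below; $f_1$ is differentiable and $\nabla f_1$ is $L$-Lipschitz; $\nabla f_2$ is locally Lipschitz (this is automatic if $f$ is twice continuously differentiable); * $h$ is (finite and) continuous on $\mathbb R^d$ and bounded below; * $F$ is coercive, i.e. $F(\mathbf x)\to+\infty$ as $\|\mathbf x\|\to\infty$, and satisfies the Kurdyka–Łojasiewicz property: for every $\bar{\mathbf x}$ with $\partial F(\bar{\mathbf x})\neq\emptyset$ there are $\eta>0$, a neighbourhood $U$ of $\bar{\mathbf x}$ and a continuous concave $\varphi:[0,\eta)\to[0,\infty)$ with $\varphi(0)=0$, $\varphi$ of class $C^1$ with $\varphi'>0$ on $(0,\eta)$, such that $\varphi'(F(\mathbf x)-F(\bar{\mathbf x}))\,\mathrm{dist}(0,\partial F(\mathbf x))\ge 1$ for all $\mathbf x\in U$ with $F(\bar{\mathbf x})<F(\mathbf x)<F(\bar{\mathbf x})+\eta$, where $\partial F$ is the limiting subdifferential and $\mathrm{dist}(0,\emptyset)=+\infty$;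 * there is a constant $L_{h_2}$ with $\|\mathbf u-\mathbf v\|\le L_{h_2}\|\mathbf x-\mathbf y\|$ for all $\mathbf x,\mathbf y$, $\mathbf u\in\partial h_2(\mathbf x)$, $\mathbf v\in\partial h_2(\mathbf y)$. Let $\alpha\in(0,1/2)$ and let $\{\mathbf x_k\}_{k\ge0}$ be generated by the DC proximal Newton algorithm: $\mathbf x_0\in\mathbb R^d$ is arbitrary and, for every $k\ge 0$, $\mathbf H_k$ is symmetric positive definite, $\mathbf z_{h_2,k}\in\partial h_2(\mathbf x_k)$, $\mathbf v_k=\nabla f_1(\mathbf x_k)-\nabla f_2(\mathbf x_k)-\mathbf z_{h_2,k}$, $$\mathbf z_k=\mathbf x_k+\Delta\mathbf x_k=\mathrm{prox}_{h_1}^{\mathbf H_k}(\mathbf x_k-\mathbf H_k^{-1}\mathbf v_k),\qquad \mathrm{prox}_{h_1}^{\mathbf H}(\mathbf x)=\arg\min_{\mathbf y}\tfrac12(\mathbf x-\mathbf y)^\top\mathbf H(\mathbf x-\mathbf y)+h_1(\mathbf y),$$ and $\mathbf x_{k+1}=\mathbf x_k+t_k\Delta\mathbf x_k$, where the step size $t_k\in(0,1]$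 (found for instance by backtracking from $1$) satisfies the sufficient descent condition $F(\mathbf x_{k+1})-F(\mathbf x_k)\le\alpha\,t_k\,\big(\mathbf v_k^\top\Delta\mathbf x_k+h_1(\mathbf x_k+\Delta\mathbf x_k)-h_1(\mathbf x_k)\big)$. Assume moreover that * there are $m>0$ and $M$ with $m\mathbf I\preceq\mathbf H_k\preceq M\mathbf I$ for all $k$; * for all $k$ and all $\mathbf z$, $f_1(\mathbf z)\le f_1(\mathbf x_k)+\nabla f_1(\mathbf x_k)^\top(\mathbf z-\mathbf x_k)+\tfrac12(\mathbf z-\mathbf x_k)^\top\mathbf H_k(\mathbf z-\mathbf x_k)$; * there is $\tilde\alpha\in(0,1]$ with $F(\mathbf x_{k+1})\le(1-\tilde\alpha)F(\mathbf x_k)+\tilde\alpha F(\mathbf z_k)$ for all $k$. Then the whole sequence $\{\mathbf x_k\}$ converges to a critical point $\mathbf x^\star$ of $F$: $0\in\nabla f_1(\mathbf x^\star)-\nabla f_2(\mathbf x^\star)+\partial h_1(\mathbf x^\star)-\partial h_2(\mathbf x^\star)$, and also $0\in\partial F(\mathbf x^\star)$. -/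

import Mathlib

open Filter Topology
open scoped NNReal Matrix

namespace DCProxNewton

noncomputable section

/-- Euclidean space of dimension `d`. -/
abbrev Euc (d : ℕ) : Type := EuclideanSpace ℝ (Fin d)

/-! ### Subdifferentials -/

/-- The subdifferential, in the sense of convex analysis, of a real-valued function at `x`. -/
def convexSubdifferential {d : ℕ} (g : Euc d → ℝ) (x : Euc d) : Set (Euc d) :=
  {u | ∀ y, g x + inner ℝ u (y - x) ≤ g y}

/-- The Fréchet (regular) subdifferential of `F` at `x`: those `v` with
`F y ≥ F x + ⟨v, y - x⟩ - o(‖y - x‖)` as `y → x`. -/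
def frechetSubdifferential {d : ℕ} (F : Euc d → ℝ) (x : Euc d) : Set (Euc d) :=
  {v | ∀ ε : ℝ, 0 < ε → ∀ᶠ y in 𝓝 x, F x + inner ℝ v (y - x) - ε * ‖y - x‖ ≤ F y}

/-- The limiting (Mordukhovich) subdifferential of `F` at `x`: limits of Fréchet subgradients
`v n` at points `y n → x` with `F (y n) → F x`. -/
def limitingSubdifferential {d : ℕ} (F : Euc d → ℝ) (x : Euc d) : Set (Euc d) :=
  {v | ∃ y w : ℕ → Euc d,
    Tendsto y atTop (𝓝 x) ∧ Tendsto (fun n => F (y n)) atTop (𝓝 (F x)) ∧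
    (∀ n, w n ∈ frechetSubdifferential F (y n)) ∧ Tendsto w atTop (𝓝 v)}

/-! ### The Kurdyka–Łojasiewicz property -/

/-- Desingularizing functions on `[0, η)`. -/
structure IsDesingularizing (η : ℝ) (φ : ℝ → ℝ) : Prop where
  map_zero : φ 0 = 0
  continuousOn : ContinuousOn φ (Set.Ico 0 η)
  concaveOn : ConcaveOn ℝ (Set.Ico 0 η) φ
  contDiffOn : ContDiffOn ℝ 1 φ (Set.Ioo 0 η)
  deriv_pos : ∀ s ∈ Set.Ioo 0 η, 0 < deriv φ s

/-- The Kurdyka–Łojasiewicz property of `F` at `p`: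
`φ' (F x - F p) * dist (0, ∂F x) ≥ 1` for all `x` near `p` with `F p < F x < F p + η`.
Bounding the norm of every subgradient from below is the bound on the distance, with the
convention that the distance to the empty set is `+∞`. -/
def KLPropertyAt {d : ℕ} (F : Euc d → ℝ) (p : Euc d) : Prop :=
  ∃ η : ℝ, 0 < η ∧ ∃ φ : ℝ → ℝ, IsDesingularizing η φ ∧ ∃ U ∈ 𝓝 p, ∀ x ∈ U,
    F p < F x → F x < F p + η →
      ∀ v ∈ limitingSubdifferential F x, 1 ≤ deriv φ (F x - F p) * ‖v‖

/-- `F` satisfies the Kurdyka–Łojasiewicz property: it does so at each point of the domain of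
its limiting subdifferential. -/
def KLProperty {d : ℕ} (F : Euc d → ℝ) : Prop :=
  ∀ p, (limitingSubdifferential F p).Nonempty → KLPropertyAt F p

/-- `F x → +∞` as `‖x‖ → +∞`. -/
def Coercive {d : ℕ} (F : Euc d → ℝ) : Prop :=
  Tendsto F (comap (fun x => ‖x‖) atTop) atTop

/-! ### The optimization problem -/

/-- The objective `F = f + h` with `f = f₁ - f₂` and `h = h₁ - h₂`. -/
def objective {d : ℕ} (f₁ f₂ h₁ h₂ : Euc d → ℝ) (x : Euc d) : ℝ :=
  (f₁ x - f₂ x) + (h₁ x - h₂ x)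

/-- The assumptions on `f = f₁ - f₂`: it is twice differentiable and bounded below, `f₁` and
`f₂` are convex, and `f₁` has an `L`-Lipschitz gradient. -/
structure SmoothPart {d : ℕ} (f₁ f₂ : Euc d → ℝ) (L : ℝ≥0) : Prop where
  differentiable : Differentiable ℝ (fun x => f₁ x - f₂ x)
  differentiable_fderiv : Differentiable ℝ (fderiv ℝ (fun x => f₁ x - f₂ x))
  bddBelow : BddBelow (Set.range (fun x => f₁ x - f₂ x))
  convex₁ : ConvexOn ℝ Set.univ f₁
  convex₂ : ConvexOn ℝ Set.univ f₂
  differentiable₁ : Differentiable ℝ f₁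
  lipschitz₁ : LipschitzWith L (gradient f₁)

/-- The assumptions on `h = h₁ - h₂`: it is finite and continuous on the whole space and bounded
below, and `h₁` and `h₂` are convex. -/
structure NonsmoothPart {d : ℕ} (h₁ h₂ : Euc d → ℝ) : Prop where
  continuous : Continuous (fun x => h₁ x - h₂ x)
  bddBelow : BddBelow (Set.range (fun x => h₁ x - h₂ x))
  convex₁ : ConvexOn ℝ Set.univ h₁
  convex₂ : ConvexOn ℝ Set.univ h₂

/-- Stationary points:
`0 ∈ ∇f₁ x - ∇f₂ x + ∂h₁ x - ∂h₂ x`. -/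
def IsStationaryPoint {d : ℕ} (f₁ f₂ h₁ h₂ : Euc d → ℝ) (x : Euc d) : Prop :=
  ∃ u ∈ convexSubdifferential h₁ x, ∃ w ∈ convexSubdifferential h₂ x,
    gradient f₁ x - gradient f₂ x + u - w = 0

/-! ### The algorithm -/

/-- The action of a matrix on a vector of Euclidean space. -/
def mulEuc {d : ℕ} (A : Matrix (Fin d) (Fin d) ℝ) (x : Euc d) : Euc d :=
  WithLp.toLp 2 (A *ᵥ x.ofLp)

/-- `‖x‖²_A = xᵀ A x`. -/
def sqNorm {d : ℕ} (A : Matrix (Fin d) (Fin d) ℝ) (x : Euc d) : ℝ :=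
  inner ℝ x (mulEuc A x)

/-- `y` is the proximal point `prox_g^A (x) = argmin_y ½ ‖x - y‖²_A + g y`. -/
def IsProx {d : ℕ} (A : Matrix (Fin d) (Fin d) ℝ) (g : Euc d → ℝ) (x y : Euc d) : Prop :=
  ∀ y' : Euc d, 1 / 2 * sqNorm A (x - y) + g y ≤ 1 / 2 * sqNorm A (x - y') + g y'

/-- The data produced by a run of the algorithm: the iterates `x k`, the metrics `H k`, the
chosen subgradients `zh k` of `h₂`, the search directions `Δ k` and the step sizes `t k`. -/
structure Run (d : ℕ) where
  x : ℕ → Euc d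
  H : ℕ → Matrix (Fin d) (Fin d) ℝ
  zh : ℕ → Euc d
  Δ : ℕ → Euc d
  t : ℕ → ℝ

/-- The vector `v k = ∇f₁ (x k) - ∇f₂ (x k) - zh k`. -/
def Run.v {d : ℕ} (R : Run d) (f₁ f₂ : Euc d → ℝ) (k : ℕ) : Euc d :=
  gradient f₁ (R.x k) - gradient f₂ (R.x k) - R.zh k

/-- The quantity `D k = ⟨v k, Δ k⟩ + h₁ (x k + Δ k) - h₁ (x k)` of the descent condition. -/
def Run.D {d : ℕ} (R : Run d) (f₁ f₂ h₁ : Euc d → ℝ) (k : ℕ) : ℝ :=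
  inner ℝ (R.v f₁ f₂ k) (R.Δ k) + h₁ (R.x k + R.Δ k) - h₁ (R.x k)

/-- `R` is a run of the DC proximal Newton algorithm with descent parameter `α`. The step sizes
are allowed to be any elements of `(0, 1]` that pass the sufficient descent test; this covers
every backtracking rule started at `1`. -/
structure Run.IsDCProxNewton {d : ℕ} (R : Run d) (f₁ f₂ h₁ h₂ : Euc d → ℝ) (α : ℝ) : Prop where
  posDef : ∀ k, (R.H k).PosDef
  subgradient : ∀ k, R.zh k ∈ convexSubdifferential h₂ (R.x k)
  direction : ∀ k,
    IsProx (R.H k) h₁ (R.x k - mulEuc (R.H k)⁻¹ (R.v f₁ f₂ k)) (R.x k + R.Δ k)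
  step_pos : ∀ k, 0 < R.t k
  step_le_one : ∀ k, R.t k ≤ 1
  descent : ∀ k, objective f₁ f₂ h₁ h₂ (R.x (k + 1)) - objective f₁ f₂ h₁ h₂ (R.x k)
    ≤ α * R.t k * R.D f₁ f₂ h₁ k
  update : ∀ k, R.x (k + 1) = R.x k + R.t k • R.Δ k

end

end DCProxNewton

/-! Write `zₖ = xₖ + Δₖ`, `δₖ = ‖Δₖ‖`, and `rₖ = F xₖ - ℓ` with `ℓ = lim F xₖ`. Prox optimality and
the majorization of `f₁` give `F zₖ ≤ F xₖ - (m/2) δₖ²`. The averaging condition passes a share `α'`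
of this to `xₖ₊₁`, so `c δₖ² ≤ rₖ - rₖ₊₁` with `c = α' m / 2`, and `δₖ → 0`.

Prox optimality also yields a subgradient of `F` of norm at most `C δₖ`, but at `zₖ` rather than at
`xₖ₊₁` (`Run.exists_subgradient_norm_le`). The KL inequality therefore holds at the level `s = F zₖ
- ℓ`, which may be far below `rₖ₊₁`, even negative. `IsDesingularizing.step_le` splits into two
cases. If `s > rₖ₊₁/2`, concavity of `φ` moves the inequality to `rₖ₊₁/2` and the usual KL estimate
applies. If `s ≤ rₖ₊₁/2`, averaging makes `√r` contract by a fixed factor, so `δₖ₊₁` is bounded by a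
telescoping difference of square roots.

Either way `δₖ₊₁ ≤ δₖ/2 + θₖ - θₖ₊₁` near a cluster point, which coercivity provides;
`tendsto_of_step_le` then traps the sequence there. -/

namespace DCProxNewton

variable {d : ℕ}

/-! ### Subgradients of convex functions -/

/-- Supporting hyperplane: `(x, g x)` is separated from the strict epigraph, open by continuity of
`g`. The vertical coefficient `c` is negative, so dividing by `-c` turns the horizontal part into a
subgradient. -/
theorem convexSubdifferential_nonempty {g : Euc d → ℝ} (hg : ConvexOn ℝ Set.univ g) (x : Euc d) :
    (convexSubdifferential g x).Nonempty := by
  have hcont : Continuous g := hg.locallyLipschitz.continuous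
  have hconv : Convex ℝ {p : Euc d × ℝ | g p.1 < p.2} := by
    have := hg.convex_strict_epigraph
    simpa using this
  have hopen : IsOpen {p : Euc d × ℝ | g p.1 < p.2} :=
    isOpen_lt (hcont.comp continuous_fst) continuous_snd
  obtain ⟨l, hl⟩ := geometric_hahn_banach_open_point hconv hopen (x := (x, g x)) (by simp)
  set l₁ : StrongDual ℝ (Euc d) := l.comp (ContinuousLinearMap.inl ℝ (Euc d) ℝ)
  set c : ℝ := l (0, 1)
  have hsplit : ∀ y t, l (y, t) = l₁ y + c * t := by
    intro y t
    have : (y, t) = (y, (0 : ℝ)) + t • ((0 : Euc d), (1 : ℝ)) := by simp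
    rw [this, map_add, map_smul, smul_eq_mul, mul_comm]
    rfl
  have hc : c < 0 := by
    have := hl (x, g x + 1) (by simp)
    rw [hsplit, hsplit] at this
    linarith
  have hle : ∀ y, l₁ y + c * g y ≤ l₁ x + c * g x := by
    intro y
    refine le_of_forall_pos_le_add fun ε hε => ?_
    have := hl (y, g y + ε / (-c)) (by simpa using div_pos hε (neg_pos.2 hc))
    rw [hsplit, hsplit] at this
    have h2 : c * (ε / (-c)) = -ε := by
      rw [div_neg, mul_neg, mul_div_cancel₀ _ hc.ne]
    linarith [mul_add c (g y) (ε / (-c))]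
  refine ⟨(-c)⁻¹ • (InnerProductSpace.toDual ℝ (Euc d)).symm l₁, fun y => ?_⟩
  rw [real_inner_smul_left, InnerProductSpace.toDual_symm_apply, map_sub]
  have h1 := hle y
  have hc' : 0 < -c := neg_pos.2 hc
  have h3 : (-c)⁻¹ * (l₁ y - l₁ x) ≤ g y - g x := by
    rw [inv_mul_le_iff₀ hc']
    linarith
  linarith

theorem eq_gradient_of_mem_convexSubdifferential {g : Euc d → ℝ} {x u : Euc d}
    (hd : DifferentiableAt ℝ g x) (hu : u ∈ convexSubdifferential g x) : u = gradient g x := by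
  have hmin : IsLocalMin (fun y => g y - inner ℝ u y) x := by
    refine Filter.Eventually.of_forall fun y => ?_
    have := hu y
    rw [inner_sub_right] at this
    linarith
  have hg : HasFDerivAt (fun y => g y - inner ℝ u y)
      (fderiv ℝ g x - InnerProductSpace.toDual ℝ (Euc d) u) x := by
    have h2 : HasFDerivAt (fun y => inner ℝ u y) (InnerProductSpace.toDual ℝ (Euc d) u) x :=
      (InnerProductSpace.toDual ℝ (Euc d) u).hasFDerivAt
    exact hd.hasFDerivAt.sub h2
  have h0 := hmin.hasFDerivAt_eq_zero hg
  rw [sub_eq_zero] at h0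
  rw [gradient, h0, LinearIsometryEquiv.symm_apply_apply]

theorem gradient_mem_convexSubdifferential {g : Euc d → ℝ} (hg : ConvexOn ℝ Set.univ g)
    {x : Euc d} (hd : DifferentiableAt ℝ g x) : gradient g x ∈ convexSubdifferential g x := by
  obtain ⟨u, hu⟩ := convexSubdifferential_nonempty hg x
  exact eq_gradient_of_mem_convexSubdifferential hd hu ▸ hu

theorem mem_convexSubdifferential_of_tendsto {g : Euc d → ℝ} (hg : Continuous g)
    {y u : ℕ → Euc d} {x w : Euc d} (hy : Tendsto y atTop (𝓝 x)) (hu : Tendsto u atTop (𝓝 w))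
    (h : ∀ n, u n ∈ convexSubdifferential g (y n)) : w ∈ convexSubdifferential g x := by
  intro z
  refine le_of_tendsto (f := fun n => g (y n) + inner ℝ (u n) (z - y n)) (x := atTop) ?_
    (Eventually.of_forall fun n => h n z)
  exact ((hg.tendsto x).comp hy).add (hu.inner (tendsto_const_nhds.sub hy))

/-! ### Fréchet and limiting subgradients -/

theorem add_mem_frechetSubdifferential {F G : Euc d → ℝ} {x v w : Euc d}
    (hv : v ∈ frechetSubdifferential F x) (hw : w ∈ frechetSubdifferential G x) :
    v + w ∈ frechetSubdifferential (fun y => F y + G y) x := by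
  intro ε hε
  filter_upwards [hv (ε / 2) (half_pos hε), hw (ε / 2) (half_pos hε)] with y h1 h2
  rw [inner_add_left]
  linarith

theorem mem_frechetSubdifferential_of_mem_convexSubdifferential {g : Euc d → ℝ} {x u : Euc d}
    (hu : u ∈ convexSubdifferential g x) : u ∈ frechetSubdifferential g x := by
  intro ε hε
  refine Eventually.of_forall fun y => ?_
  have := hu y
  have := mul_nonneg hε.le (norm_nonneg (y - x))
  linarith

theorem gradient_mem_frechetSubdifferential {g : Euc d → ℝ} {x : Euc d}
    (hd : DifferentiableAt ℝ g x) : gradient g x ∈ frechetSubdifferential g x := by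
  intro ε hε
  have h := (hasGradientAt_iff_isLittleO.1 hd.hasGradientAt).def hε
  filter_upwards [h] with y hy
  have := (abs_le.1 (Real.norm_eq_abs _ ▸ hy)).1
  linarith

theorem neg_gradient_mem_frechetSubdifferential_neg {g : Euc d → ℝ} {x : Euc d}
    (hd : DifferentiableAt ℝ g x) :
    -gradient g x ∈ frechetSubdifferential (fun y => -g y) x := by
  intro ε hε
  have h := (hasGradientAt_iff_isLittleO.1 hd.hasGradientAt).def hε
  filter_upwards [h] with y hy
  have := (abs_le.1 (Real.norm_eq_abs _ ▸ hy)).2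
  rw [inner_neg_left]
  linarith

/-- A convex function whose subgradients vary in a Lipschitz way is differentiable; this is the
corresponding statement about Fréchet subgradients of its negative. -/
theorem neg_mem_frechetSubdifferential_neg {g : Euc d → ℝ} (hg : ConvexOn ℝ Set.univ g) {K : ℝ}
    (hK : ∀ x y, ∀ u ∈ convexSubdifferential g x, ∀ v ∈ convexSubdifferential g y,
      ‖u - v‖ ≤ K * ‖x - y‖)
    {x u : Euc d} (hu : u ∈ convexSubdifferential g x) :
    -u ∈ frechetSubdifferential (fun y => -g y) x := by
  intro ε hε
  have hK' : 0 < |K| + 1 := by positivity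
  filter_upwards [Metric.ball_mem_nhds x (div_pos hε hK')] with y hy
  -- A subgradient at the nearby point `y`, tested at `x`, bounds `g y` from above; replacing `w` by
  -- `u` costs at most `ε * ‖y - x‖`.
  obtain ⟨w, hw⟩ := convexSubdifferential_nonempty hg y
  have h1 := hw x
  have h2 : ‖w - u‖ ≤ ε := by
    have h3 := hK y x w hw u hu
    rw [Metric.mem_ball, dist_eq_norm, lt_div_iff₀ hK'] at hy
    nlinarith [le_abs_self K, norm_nonneg (y - x)]
  have h4 : inner ℝ (w - u) (y - x) ≤ ε * ‖y - x‖ :=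
    (real_inner_le_norm _ _).trans (mul_le_mul_of_nonneg_right h2 (norm_nonneg _))
  rw [inner_neg_left]
  rw [inner_sub_left] at h4
  rw [← neg_sub y x, inner_neg_right] at h1
  linarith

theorem mem_limitingSubdifferential_of_mem_frechetSubdifferential {F : Euc d → ℝ} {x v : Euc d}
    (hv : v ∈ frechetSubdifferential F x) : v ∈ limitingSubdifferential F x :=
  ⟨fun _ => x, fun _ => v, tendsto_const_nhds, tendsto_const_nhds, fun _ => hv,
    tendsto_const_nhds⟩

/-! ### Quadratic forms -/

theorem mulEuc_eq (A : Matrix (Fin d) (Fin d) ℝ) (x : Euc d) :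
    mulEuc A x = Matrix.toEuclideanLin A x := rfl

theorem mulEuc_add (A : Matrix (Fin d) (Fin d) ℝ) (x y : Euc d) :
    mulEuc A (x + y) = mulEuc A x + mulEuc A y := by simp [mulEuc_eq]

theorem mulEuc_sub (A : Matrix (Fin d) (Fin d) ℝ) (x y : Euc d) :
    mulEuc A (x - y) = mulEuc A x - mulEuc A y := by simp [mulEuc_eq]

theorem mulEuc_neg (A : Matrix (Fin d) (Fin d) ℝ) (x : Euc d) :
    mulEuc A (-x) = -mulEuc A x := by simp [mulEuc_eq]

theorem mulEuc_smul (A : Matrix (Fin d) (Fin d) ℝ) (c : ℝ) (x : Euc d) :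
    mulEuc A (c • x) = c • mulEuc A x := by simp [mulEuc_eq]

theorem mulEuc_mulEuc_inv {A : Matrix (Fin d) (Fin d) ℝ} (hA : A.PosDef) (x : Euc d) :
    mulEuc A (mulEuc A⁻¹ x) = x := by
  have hdet : IsUnit A.det := hA.det_pos.ne'.isUnit
  simp [mulEuc, Matrix.mulVec_mulVec, Matrix.mul_nonsing_inv A hdet]

theorem inner_mulEuc_comm {A : Matrix (Fin d) (Fin d) ℝ} (hA : A.IsHermitian) (x y : Euc d) :
    inner ℝ (mulEuc A x) y = inner ℝ x (mulEuc A y) := by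
  simp only [mulEuc_eq]
  exact (Matrix.isSymmetric_toEuclideanLin_iff.2 hA) x y

theorem sqNorm_nonneg {A : Matrix (Fin d) (Fin d) ℝ} (hA : A.PosSemidef) (x : Euc d) :
    0 ≤ sqNorm A x := by
  have := hA.dotProduct_mulVec_nonneg x.ofLp
  simpa [sqNorm, mulEuc, EuclideanSpace.inner_eq_star_dotProduct, dotProduct_comm] using this

theorem sqNorm_sub_matrix (A B : Matrix (Fin d) (Fin d) ℝ) (x : Euc d) :
    sqNorm (A - B) x = sqNorm A x - sqNorm B x := by
  simp [sqNorm, mulEuc_eq, inner_sub_right]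

theorem sqNorm_smul_one (c : ℝ) (x : Euc d) :
    sqNorm (c • (1 : Matrix (Fin d) (Fin d) ℝ)) x = c * ‖x‖ ^ 2 := by
  have : mulEuc (c • (1 : Matrix (Fin d) (Fin d) ℝ)) x = c • x := by
    simp [mulEuc, Matrix.smul_mulVec]
  rw [sqNorm, this, real_inner_smul_right, real_inner_self_eq_norm_sq]

theorem mul_norm_sq_le_sqNorm {A : Matrix (Fin d) (Fin d) ℝ} {m : ℝ}
    (hA : (A - m • (1 : Matrix (Fin d) (Fin d) ℝ)).PosSemidef) (x : Euc d) :
    m * ‖x‖ ^ 2 ≤ sqNorm A x := by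
  have := sqNorm_nonneg hA x
  rw [sqNorm_sub_matrix, sqNorm_smul_one] at this
  linarith

theorem sqNorm_le_mul_norm_sq {A : Matrix (Fin d) (Fin d) ℝ} {M : ℝ}
    (hA : (M • (1 : Matrix (Fin d) (Fin d) ℝ) - A).PosSemidef) (x : Euc d) :
    sqNorm A x ≤ M * ‖x‖ ^ 2 := by
  have := sqNorm_nonneg hA x
  rw [sqNorm_sub_matrix, sqNorm_smul_one] at this
  linarith

theorem sqNorm_add_smul {A : Matrix (Fin d) (Fin d) ℝ} (hA : A.IsHermitian) (x y : Euc d)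
    (c : ℝ) :
    sqNorm A (x + c • y) = sqNorm A x + 2 * c * inner ℝ (mulEuc A x) y + c ^ 2 * sqNorm A y := by
  simp only [sqNorm, mulEuc_add, mulEuc_smul, inner_add_left, inner_add_right,
    real_inner_smul_left, real_inner_smul_right, ← inner_mulEuc_comm hA x y]
  rw [real_inner_comm (mulEuc A x) y]
  ring

/-- Cauchy–Schwarz for the semidefinite form, via the discriminant: with `y = A x`, `‖y‖⁴ ≤ ⟨x, A x⟩
⟨y, A y⟩ ≤ M² ‖x‖² ‖y‖²`. -/
theorem norm_mulEuc_le {A : Matrix (Fin d) (Fin d) ℝ} (hA : A.PosSemidef) {M : ℝ}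
    (hAM : (M • (1 : Matrix (Fin d) (Fin d) ℝ) - A).PosSemidef) (x : Euc d) :
    ‖mulEuc A x‖ ≤ |M| * ‖x‖ := by
  set y := mulEuc A x
  rcases eq_or_ne ‖y‖ 0 with h0 | h0
  · rw [h0]; positivity
  have hdiscr : ∀ c : ℝ, 0 ≤ sqNorm A y * (c * c) + 2 * ‖y‖ ^ 2 * c + sqNorm A x := by
    intro c
    have h := sqNorm_nonneg hA (x + c • y)
    rw [sqNorm_add_smul hA.1] at h
    have h2 : inner ℝ (mulEuc A x) y = ‖y‖ ^ 2 := real_inner_self_eq_norm_sq y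
    rw [h2] at h
    linarith
  have hd := discrim_le_zero hdiscr
  rw [discrim] at hd
  have h1 : sqNorm A y ≤ |M| * ‖y‖ ^ 2 := (sqNorm_le_mul_norm_sq hAM y).trans
    (mul_le_mul_of_nonneg_right (le_abs_self M) (sq_nonneg _))
  have h2 : sqNorm A x ≤ |M| * ‖x‖ ^ 2 := (sqNorm_le_mul_norm_sq hAM x).trans
    (mul_le_mul_of_nonneg_right (le_abs_self M) (sq_nonneg _))
  have h3 : sqNorm A y * sqNorm A x ≤ (|M| * ‖y‖ ^ 2) * (|M| * ‖x‖ ^ 2) :=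
    mul_le_mul h1 h2 (sqNorm_nonneg hA x) (by positivity)
  have hy : 0 < ‖y‖ ^ 2 := by positivity
  refine le_of_sq_le_sq ?_ (by positivity)
  refine le_of_mul_le_mul_left ?_ hy
  nlinarith

/-- The optimality condition of the proximal subproblem. -/
theorem IsProx.mulEuc_sub_mem {A : Matrix (Fin d) (Fin d) ℝ} (hA : A.IsHermitian)
    {g : Euc d → ℝ} (hg : ConvexOn ℝ Set.univ g) {x z : Euc d} (h : IsProx A g x z) :
    mulEuc A (x - z) ∈ convexSubdifferential g z := by
  intro y
  -- Compare `z` with a point on the segment towards `y` and divide by `c`; the quadratic term is of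
  -- order `c` and vanishes in the limit.
  have key : ∀ c ∈ Set.Ioc (0 : ℝ) 1,
      g z + inner ℝ (mulEuc A (x - z)) (y - z) ≤ g y + c * (1 / 2 * sqNorm A (y - z)) := by
    rintro c ⟨hc0, hc1⟩
    have h1 := h (z + c • (y - z))
    have h2 : x - (z + c • (y - z)) = (x - z) + (-c) • (y - z) := by module
    rw [h2, sqNorm_add_smul hA] at h1
    have h3 : g (z + c • (y - z)) ≤ (1 - c) * g z + c * g y := by
      have := hg.2 (Set.mem_univ z) (Set.mem_univ y) (sub_nonneg.2 hc1) hc0.le (by ring)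
      have h4 : (1 - c) • z + c • y = z + c • (y - z) := by module
      rwa [h4] at this
    refine le_of_mul_le_mul_left ?_ hc0
    nlinarith
  have hlim : Tendsto (fun c : ℝ => g y + c * (1 / 2 * sqNorm A (y - z))) (𝓝[>] 0) (𝓝 (g y)) := by
    have : Continuous (fun c : ℝ => g y + c * (1 / 2 * sqNorm A (y - z))) := by fun_prop
    simpa using (this.tendsto 0).mono_left nhdsWithin_le_nhds
  exact ge_of_tendsto hlim (mem_of_superset (Ioc_mem_nhdsGT one_pos) key)

end DCProxNewton

namespace DCProxNewton

/-! ### Desingularizing functions -/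

namespace IsDesingularizing

variable {η : ℝ} {φ : ℝ → ℝ}

theorem differentiableAt (h : IsDesingularizing η φ) {s : ℝ} (hs : s ∈ Set.Ioo 0 η) :
    DifferentiableAt ℝ φ s :=
  ((h.contDiffOn.differentiableOn one_ne_zero) s hs).differentiableAt (isOpen_Ioo.mem_nhds hs)

theorem monotoneOn (h : IsDesingularizing η φ) : MonotoneOn φ (Set.Ico 0 η) := by
  refine monotoneOn_of_deriv_nonneg (convex_Ico 0 η) h.continuousOn ?_ ?_ <;> rw [interior_Ico]
  · exact fun s hs => (h.differentiableAt hs).differentiableWithinAt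
  · exact fun s hs => (h.deriv_pos s hs).le

theorem deriv_le_deriv (h : IsDesingularizing η φ) {s t : ℝ} (hs : 0 < s) (hst : s ≤ t)
    (ht : t < η) : deriv φ t ≤ deriv φ s :=
  (h.concaveOn.subset Set.Ioo_subset_Ico_self (convex_Ioo 0 η)).antitoneOn_deriv
    (fun _ hx => h.differentiableAt hx) ⟨hs, hst.trans_lt ht⟩ ⟨hs.trans_le hst, ht⟩ hst

theorem deriv_mul_sub_le (h : IsDesingularizing η φ) {s t : ℝ} (hs : 0 ≤ s) (hst : s ≤ t)
    (ht0 : 0 < t) (ht : t < η) : deriv φ t * (t - s) ≤ φ t - φ s := by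
  rcases hst.eq_or_lt with rfl | hlt
  · simp
  have := h.concaveOn.deriv_le_slope ⟨hs, hst.trans_lt ht⟩ ⟨hs.trans hst, ht⟩ hlt
    (h.differentiableAt ⟨ht0, ht⟩)
  rwa [slope_def_field, le_div_iff₀ (sub_pos.2 hlt)] at this

end IsDesingularizing

/-! ### Recursive estimates -/

/-- If a decrease of the objective values is a fixed share of the decrease towards the level `s`,
and `s` is below half of the new value, then the square roots of the values contract. -/
theorem sqrt_le_of_contraction {a r₀ r₁ s : ℝ} (ha : a ∈ Set.Ioc (0 : ℝ) 1) (hr₀ : 0 ≤ r₀)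
    (hr₁ : r₁ ≤ (1 - a) * r₀ + a * s) (hs : s ≤ r₁ / 2) :
    √r₀ ≤ 4 / a * (√r₀ - √r₁) := by
  obtain ⟨ha0, ha1⟩ := ha
  have h1 : r₁ ≤ ((1 - a / 4) * √r₀) ^ 2 := by
    rw [mul_pow, Real.sq_sqrt hr₀]
    have h2 : r₁ * (1 - a / 2) ≤ (1 - a) * r₀ := by nlinarith
    have h3 : (1 - a) * r₀ ≤ (1 - a / 4) ^ 2 * r₀ * (1 - a / 2) := by
      -- The right side expands to `1 - a + 5a²/16 - a³/32`.
      have : 1 - a ≤ (1 - a / 4) ^ 2 * (1 - a / 2) := by nlinarith [mul_pos ha0 ha0, pow_pos ha0 3]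
      nlinarith
    exact le_of_mul_le_mul_right (h2.trans h3) (by linarith)
  have h4 : √r₁ ≤ (1 - a / 4) * √r₀ :=
    Real.sqrt_le_iff.2 ⟨mul_nonneg (by linarith) (Real.sqrt_nonneg _), h1⟩
  rw [div_mul_eq_mul_div, le_div_iff₀ ha0]
  linarith

/-- One step of the finite-length argument. The Kurdyka–Łojasiewicz inequality is only available at
a level `s` which may lie below the next value `r₁`. -/
theorem IsDesingularizing.step_le {η : ℝ} {φ : ℝ → ℝ} (hφ : IsDesingularizing η φ)
    {a c C r₀ r₁ r₂ s δ₀ δ₁ : ℝ} (ha : a ∈ Set.Ioc (0 : ℝ) 1) (hc : 0 < c) (hC : 0 < C)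
    (hr₂ : 0 ≤ r₂) (hr₁₀ : r₁ ≤ r₀) (hr₀ : r₀ < η) (hs₀ : s ≤ r₀)
    (hr₁ : r₁ ≤ (1 - a) * r₀ + a * s) (hδ₀ : 0 ≤ δ₀)
    (hdec : c * δ₁ ^ 2 ≤ r₁ - r₂) (hKL : 0 < s → 1 ≤ deriv φ s * (C * δ₀)) :
    δ₁ ≤ δ₀ / 2 + C / c * (φ (r₁ / 2) - φ (r₂ / 2)) + 4 / a / √c * (√r₀ - √r₁) := by
  have hr₂₁ : r₂ ≤ r₁ := by nlinarith [sq_nonneg δ₁]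
  have hr₁' : 0 ≤ r₁ := hr₂.trans hr₂₁
  have hφmono : 0 ≤ φ (r₁ / 2) - φ (r₂ / 2) :=
    sub_nonneg.2 (hφ.monotoneOn ⟨by linarith, by linarith⟩ ⟨by linarith, by linarith⟩ (by linarith))
  have hA : 0 ≤ C / c * (φ (r₁ / 2) - φ (r₂ / 2)) := mul_nonneg (by positivity) hφmono
  have ha0 := ha.1
  have hB : 0 ≤ 4 / a / √c * (√r₀ - √r₁) :=
    mul_nonneg (by positivity) (sub_nonneg.2 (Real.sqrt_le_sqrt hr₁₀))
  rcases le_or_gt s (r₁ / 2) with hs | hs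
  · have h1 := sqrt_le_of_contraction ha (hr₁'.trans hr₁₀) hr₁ hs
    have h2 : δ₁ ≤ √r₀ / √c := by
      rw [← Real.sqrt_div' _ hc.le]
      refine Real.le_sqrt_of_sq_le ?_
      rw [le_div_iff₀ hc]
      linarith
    have h3 : √r₀ / √c ≤ 4 / a / √c * (√r₀ - √r₁) := by
      rw [div_mul_eq_mul_div]
      exact div_le_div_of_nonneg_right h1 (Real.sqrt_nonneg _)
    linarith
  -- `φ` need not be differentiable at `0`, so `r₁ = 0` is treated apart: no decrease is left and
  -- `δ₁ = 0`.
  rcases hr₁'.eq_or_lt with h0 | hpos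
  · have : δ₁ = 0 := by
      have : δ₁ ^ 2 ≤ 0 := by
        by_contra! hcon
        nlinarith [mul_pos hc hcon]
      exact pow_eq_zero_iff two_ne_zero |>.1 (le_antisymm this (sq_nonneg _))
    linarith
  have h1 := hKL (by linarith)
  -- Since `s > r₁ / 2`, concavity gives `φ' s ≤ φ' (r₁ / 2)`: the KL bound moves to a level
  -- independent of `s`, where `φ` can telescope.
  have h2 := hφ.deriv_le_deriv (half_pos hpos) hs.le (hs₀.trans_lt hr₀)
  have h3 := hφ.deriv_mul_sub_le (s := r₂ / 2) (t := r₁ / 2) (by linarith) (by linarith)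
    (by linarith) (by linarith)
  set D := deriv φ (r₁ / 2)
  set X := φ (r₁ / 2) - φ (r₂ / 2)
  have hCδ : 0 ≤ C * δ₀ := mul_nonneg hC.le hδ₀
  have h4 : 1 ≤ D * (C * δ₀) := h1.trans (mul_le_mul_of_nonneg_right h2 hCδ)
  have h5 : c * δ₁ ^ 2 ≤ 2 * X * (C * δ₀) := by
    have h6 : 0 ≤ r₁ - r₂ := by linarith
    have h7 : (r₁ - r₂) * 1 ≤ (r₁ - r₂) * (D * (C * δ₀)) := mul_le_mul_of_nonneg_left h4 h6
    have h8 := mul_le_mul_of_nonneg_right h3 hCδ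
    nlinarith
  have h9 : δ₁ ≤ δ₀ / 2 + C / c * X := by
    refine le_of_sq_le_sq ?_ (by positivity)
    -- AM–GM: `4uv ≤ (u + v)²` with `u = δ₀ / 2` and `v = C / c * X`.
    have h10 : δ₁ ^ 2 ≤ 4 * (δ₀ / 2) * (C / c * X) := by
      have : 4 * (δ₀ / 2) * (C / c * X) = 2 * X * (C * δ₀) / c := by field_simp; ring
      rw [this, le_div_iff₀ hc]
      linarith
    nlinarith [sq_nonneg (δ₀ / 2 - C / c * X)]
  linarith

/-- A sequence that comes close to `p` and whose steps satisfy, as long as it stays near `p`, a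
contraction up to a telescoping error, converges to `p`. -/
theorem tendsto_of_step_le {E : Type*} [PseudoMetricSpace E] {x : ℕ → E} {p : E} {δ θ : ℕ → ℝ}
    {ρ : ℝ} (hρ : 0 < ρ) (hδ : ∀ k, 0 ≤ δ k) (hθ : ∀ᶠ k in atTop, 0 ≤ θ k)
    (hδ0 : Tendsto δ atTop (𝓝 0))
    (hθ0 : Tendsto θ atTop (𝓝 0)) (hx : ∀ k, dist (x (k + 1)) (x k) ≤ δ k)
    (hp : MapClusterPt p atTop x)
    (hstep : ∀ᶠ k in atTop, dist (x k) p + δ k < ρ → δ (k + 1) ≤ δ k / 2 + (θ k - θ (k + 1))) :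
    Tendsto x atTop (𝓝 p) := by
  rw [Metric.tendsto_atTop]
  intro ε hε
  have hμ : 0 < min ε ρ := lt_min hε hρ
  have hsmall : ∀ᶠ k in atTop, 2 * δ k + 2 * θ k < min ε ρ / 2 := by
    have : Tendsto (fun k => 2 * δ k + 2 * θ k) atTop (𝓝 0) := by
      simpa using (hδ0.const_mul 2).add (hθ0.const_mul 2)
    exact this.eventually_lt_const (half_pos hμ)
  have hfreq : ∃ᶠ k in atTop, dist (x k) p < min ε ρ / 2 :=
    hp.frequently (Metric.ball_mem_nhds p (half_pos hμ))
  obtain ⟨n, hn, hns, hn'⟩ := (hfreq.and_eventually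
    (hsmall.and (eventually_forall_ge_atTop.2 (hstep.and hθ)))).exists
  -- The potential `dist (x k) p + 2 * δ k + 2 * θ k` does not increase while the step estimate
  -- holds, and its smallness keeps the sequence where that estimate holds.
  have hpot : ∀ k ≥ n, dist (x k) p + 2 * δ k + 2 * θ k < min ε ρ := by
    intro k hk
    induction k, hk using Nat.le_induction with
    | base => linarith
    | succ k hk ih =>
      obtain ⟨h1, h2⟩ := hn' k hk
      have h3 := h1 (by linarith [hδ k, min_le_right ε ρ])
      linarith [dist_triangle (x (k + 1)) (x k) p, hx k]
  refine ⟨n, fun k hk => ?_⟩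
  linarith [hpot k hk, hδ k, (hn' k hk).2, min_le_left ε ρ]

end DCProxNewton

namespace DCProxNewton

/-! ### The iterates of the algorithm -/

variable {d : ℕ} {f₁ f₂ h₁ h₂ : Euc d → ℝ} {L : ℝ≥0}

theorem SmoothPart.differentiable₂ (hf : SmoothPart f₁ f₂ L) : Differentiable ℝ f₂ := by
  have h := hf.differentiable₁.sub hf.differentiable
  have h2 : (f₁ - fun x => f₁ x - f₂ x) = f₂ := by
    ext x
    simp
  rwa [h2] at h

theorem continuous_objective (hf : SmoothPart f₁ f₂ L) (hh : NonsmoothPart h₁ h₂) :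
    Continuous (objective f₁ f₂ h₁ h₂) :=
  hf.differentiable.continuous.add hh.continuous

theorem bddBelow_range_objective (hf : SmoothPart f₁ f₂ L) (hh : NonsmoothPart h₁ h₂) :
    BddBelow (Set.range (objective f₁ f₂ h₁ h₂)) := by
  obtain ⟨a, ha⟩ := hf.bddBelow
  obtain ⟨b, hb⟩ := hh.bddBelow
  refine ⟨a + b, ?_⟩
  rintro _ ⟨x, rfl⟩
  exact add_le_add (ha ⟨x, rfl⟩) (hb ⟨x, rfl⟩)

theorem Coercive.isBounded_sublevel {F : Euc d → ℝ} (hF : Coercive F) (c : ℝ) :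
    Bornology.IsBounded {x | F x ≤ c} := by
  have h := hF.eventually (eventually_gt_atTop c)
  rw [eventually_comap] at h
  obtain ⟨r, hr⟩ := eventually_atTop.1 h
  refine (Metric.isBounded_closedBall (x := (0 : Euc d)) (r := r)).subset fun x hx => ?_
  rw [mem_closedBall_zero_iff]
  by_contra! hlt
  exact absurd (hr _ hlt.le x rfl) (not_lt.2 hx)

/-- A Fréchet subgradient of the objective. -/
theorem mem_frechetSubdifferential_objective (hf : SmoothPart f₁ f₂ L)
    (hh : NonsmoothPart h₁ h₂) {K : ℝ}
    (hK : ∀ x y, ∀ u ∈ convexSubdifferential h₂ x, ∀ v ∈ convexSubdifferential h₂ y,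
      ‖u - v‖ ≤ K * ‖x - y‖)
    {x u w : Euc d} (hu : u ∈ convexSubdifferential h₁ x) (hw : w ∈ convexSubdifferential h₂ x) :
    gradient f₁ x - gradient f₂ x + u - w ∈
      frechetSubdifferential (objective f₁ f₂ h₁ h₂) x := by
  have h := add_mem_frechetSubdifferential
    (add_mem_frechetSubdifferential (gradient_mem_frechetSubdifferential (hf.differentiable₁ x))
      (neg_gradient_mem_frechetSubdifferential_neg (hf.differentiable₂ x)))
    (add_mem_frechetSubdifferential (mem_frechetSubdifferential_of_mem_convexSubdifferential hu)
      (neg_mem_frechetSubdifferential_neg hh.convex₂ hK hw))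
  have h1 : gradient f₁ x - gradient f₂ x + u - w
      = gradient f₁ x + -gradient f₂ x + (u + -w) := by abel
  have h2 : objective f₁ f₂ h₁ h₂ = fun y => f₁ y + -f₂ y + (h₁ y + -h₂ y) := by
    ext y
    simp [objective, sub_eq_add_neg]
  rwa [h1, h2]

namespace Run

variable {R : Run d} {α : ℝ}

/-- Optimality of the proximal step; `H k` cancels its inverse in front of `v k`. -/
theorem neg_v_sub_mem (hh : NonsmoothPart h₁ h₂) (hR : R.IsDCProxNewton f₁ f₂ h₁ h₂ α) (k : ℕ) :
    -R.v f₁ f₂ k - mulEuc (R.H k) (R.Δ k) ∈ convexSubdifferential h₁ (R.x k + R.Δ k) := by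
  have h := (hR.direction k).mulEuc_sub_mem (hR.posDef k).isHermitian hh.convex₁
  have h2 : R.x k - mulEuc (R.H k)⁻¹ (R.v f₁ f₂ k) - (R.x k + R.Δ k)
      = -mulEuc (R.H k)⁻¹ (R.v f₁ f₂ k) - R.Δ k := by abel
  rwa [h2, mulEuc_sub, mulEuc_neg, mulEuc_mulEuc_inv (hR.posDef k)] at h

/-- The full step decreases the objective. -/
theorem objective_add_direction_le (hf : SmoothPart f₁ f₂ L) (hh : NonsmoothPart h₁ h₂)
    (hR : R.IsDCProxNewton f₁ f₂ h₁ h₂ α)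
    (hmaj : ∀ k z, f₁ z ≤ f₁ (R.x k) + inner ℝ (gradient f₁ (R.x k)) (z - R.x k)
      + 1 / 2 * sqNorm (R.H k) (z - R.x k)) (k : ℕ) :
    objective f₁ f₂ h₁ h₂ (R.x k + R.Δ k)
      ≤ objective f₁ f₂ h₁ h₂ (R.x k) - 1 / 2 * sqNorm (R.H k) (R.Δ k) := by
  -- With `q = sqNorm (R.H k) (R.Δ k)`, majorizing `f₁` costs `q / 2` and prox optimality for `h₁`
  -- gains `q`; `-f₂` and `-h₂` lie below their linearizations.
  have e1 := hmaj k (R.x k + R.Δ k)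
  have e2 := gradient_mem_convexSubdifferential hf.convex₂ (hf.differentiable₂ (R.x k))
    (R.x k + R.Δ k)
  have e3 := hR.subgradient k (R.x k + R.Δ k)
  have e4 := neg_v_sub_mem hh hR k (R.x k)
  have hback : R.x k - (R.x k + R.Δ k) = -R.Δ k := by abel
  rw [add_sub_cancel_left] at e1 e2 e3
  rw [hback, inner_neg_right, inner_sub_left, inner_neg_left, Run.v, inner_sub_left,
    inner_sub_left, real_inner_comm (R.Δ k) (mulEuc (R.H k) (R.Δ k))] at e4
  simp only [objective]
  change _ - (_ - inner ℝ (R.Δ k) (mulEuc (R.H k) (R.Δ k))) ≤ _ at e4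
  simp only [sqNorm] at e1 ⊢
  linarith

theorem dist_succ_le (hR : R.IsDCProxNewton f₁ f₂ h₁ h₂ α) (k : ℕ) :
    dist (R.x (k + 1)) (R.x k) ≤ ‖R.Δ k‖ := by
  rw [hR.update k, dist_eq_norm, add_sub_cancel_left, norm_smul, Real.norm_eq_abs,
    abs_of_pos (hR.step_pos k)]
  exact mul_le_of_le_one_left (norm_nonneg _) (hR.step_le_one k)

/-- Near any point, the full step has a subgradient controlled by the search direction. -/
theorem exists_subgradient_norm_le (hf : SmoothPart f₁ f₂ L) (hf₂ : LocallyLipschitz (gradient f₂))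
    (hh : NonsmoothPart h₁ h₂) {K : ℝ}
    (hK : ∀ x y, ∀ u ∈ convexSubdifferential h₂ x, ∀ v ∈ convexSubdifferential h₂ y,
      ‖u - v‖ ≤ K * ‖x - y‖)
    (hR : R.IsDCProxNewton f₁ f₂ h₁ h₂ α) {M : ℝ}
    (hHM : ∀ k, (M • (1 : Matrix (Fin d) (Fin d) ℝ) - R.H k).PosSemidef) (p : Euc d) :
    ∃ ρ > 0, ∃ C > 0, ∀ k, dist (R.x k) p + ‖R.Δ k‖ < ρ →
      ∃ w ∈ frechetSubdifferential (objective f₁ f₂ h₁ h₂) (R.x k + R.Δ k),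
        ‖w‖ ≤ C * ‖R.Δ k‖ := by
  obtain ⟨L₂, V, hV, hL₂⟩ := hf₂ p
  obtain ⟨ρ, hρ, hρV⟩ := Metric.mem_nhds_iff.1 hV
  refine ⟨ρ, hρ, L + L₂ + |K| + |M| + 1, by positivity, fun k hk => ?_⟩
  have hx : R.x k ∈ V := hρV (by
    rw [Metric.mem_ball]
    linarith [norm_nonneg (R.Δ k)])
  have hz : R.x k + R.Δ k ∈ V := hρV (by
    rw [Metric.mem_ball]
    refine (dist_triangle _ (R.x k) _).trans_lt ?_
    rw [dist_eq_norm (R.x k + R.Δ k), add_sub_cancel_left]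
    linarith)
  obtain ⟨w, hw⟩ := convexSubdifferential_nonempty hh.convex₂ (R.x k + R.Δ k)
  refine ⟨_, mem_frechetSubdifferential_objective hf hh hK (neg_v_sub_mem hh hR k) hw, ?_⟩
  have e1 := hf.lipschitz₁.dist_le_mul (R.x k + R.Δ k) (R.x k)
  have e2 := hL₂.dist_le_mul _ hz _ hx
  have e3 := hK _ _ w hw _ (hR.subgradient k)
  have e4 := norm_mulEuc_le (hR.posDef k).posSemidef (hHM k) (R.Δ k)
  rw [dist_eq_norm, dist_eq_norm, add_sub_cancel_left] at e1 e2
  rw [add_sub_cancel_left] at e3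
  have e3' : ‖w - R.zh k‖ ≤ |K| * ‖R.Δ k‖ :=
    e3.trans (mul_le_mul_of_nonneg_right (le_abs_self K) (norm_nonneg _))
  -- The subgradient at the full step becomes a sum of increments between `x k` and `x k + Δ k`,
  -- plus the metric term.
  have hsplit : gradient f₁ (R.x k + R.Δ k) - gradient f₂ (R.x k + R.Δ k)
      + (-R.v f₁ f₂ k - mulEuc (R.H k) (R.Δ k)) - w
      = (gradient f₁ (R.x k + R.Δ k) - gradient f₁ (R.x k))
        - (gradient f₂ (R.x k + R.Δ k) - gradient f₂ (R.x k))
        - (w - R.zh k) - mulEuc (R.H k) (R.Δ k) := by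
    rw [Run.v]
    abel
  rw [hsplit]
  refine (norm_sub_le _ _).trans ((add_le_add_left (norm_sub_le _ _) _).trans ?_)
  have e5 := norm_sub_le (gradient f₁ (R.x k + R.Δ k) - gradient f₁ (R.x k))
    (gradient f₂ (R.x k + R.Δ k) - gradient f₂ (R.x k))
  linarith [norm_nonneg (R.Δ k)]

/-- Limits of the iterates are stationary. -/
theorem isStationaryPoint_of_tendsto (hf : SmoothPart f₁ f₂ L)
    (hf₂ : LocallyLipschitz (gradient f₂)) (hh : NonsmoothPart h₁ h₂) {K : ℝ}
    (hK : ∀ x y, ∀ u ∈ convexSubdifferential h₂ x, ∀ v ∈ convexSubdifferential h₂ y,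
      ‖u - v‖ ≤ K * ‖x - y‖)
    (hR : R.IsDCProxNewton f₁ f₂ h₁ h₂ α) {M : ℝ}
    (hHM : ∀ k, (M • (1 : Matrix (Fin d) (Fin d) ℝ) - R.H k).PosSemidef) {p : Euc d}
    (hx : Tendsto R.x atTop (𝓝 p)) (hΔ : Tendsto R.Δ atTop (𝓝 0)) :
    IsStationaryPoint f₁ f₂ h₁ h₂ p := by
  obtain ⟨w, hw⟩ := convexSubdifferential_nonempty hh.convex₂ p
  -- The Lipschitz bound makes `∂h₂` single-valued and continuous, so the chosen subgradients
  -- converge.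
  have hzh : Tendsto R.zh atTop (𝓝 w) := by
    rw [tendsto_iff_norm_sub_tendsto_zero]
    refine squeeze_zero (fun _ => norm_nonneg _)
      (fun k => hK _ _ _ (hR.subgradient k) _ hw) ?_
    simpa using (tendsto_iff_norm_sub_tendsto_zero.1 hx).const_mul K
  have hHΔ : Tendsto (fun k => mulEuc (R.H k) (R.Δ k)) atTop (𝓝 0) := by
    rw [tendsto_zero_iff_norm_tendsto_zero]
    refine squeeze_zero (fun _ => norm_nonneg _)
      (fun k => norm_mulEuc_le (hR.posDef k).posSemidef (hHM k) (R.Δ k)) ?_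
    simpa using (tendsto_zero_iff_norm_tendsto_zero.1 hΔ).const_mul |M|
  have hv : Tendsto (R.v f₁ f₂) atTop (𝓝 (gradient f₁ p - gradient f₂ p - w)) :=
    (((hf.lipschitz₁.continuous.tendsto p).comp hx).sub
      ((hf₂.continuous.tendsto p).comp hx)).sub hzh
  refine ⟨-(gradient f₁ p - gradient f₂ p - w), ?_, w, hw, by abel⟩
  refine mem_convexSubdifferential_of_tendsto hh.convex₁.locallyLipschitz.continuous
    (y := fun k => R.x k + R.Δ k) ?_ ?_ (neg_v_sub_mem hh hR)
  · simpa using hx.add hΔ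
  · simpa using hv.neg.sub hHΔ

end Run

end DCProxNewton

/-! ### Convergence of the whole sequence -/

theorem proposition2 {d : ℕ} (f₁ f₂ h₁ h₂ : DCProxNewton.Euc d → ℝ) (L : ℝ≥0)
    (hf : DCProxNewton.SmoothPart f₁ f₂ L)
    (hf₂ : LocallyLipschitz (gradient f₂))
    (hh : DCProxNewton.NonsmoothPart h₁ h₂)
    (hcoercive : DCProxNewton.Coercive (DCProxNewton.objective f₁ f₂ h₁ h₂))
    (hKL : DCProxNewton.KLProperty (DCProxNewton.objective f₁ f₂ h₁ h₂))
    (Lh₂ : ℝ)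
    (hh₂ : ∀ x y, ∀ u ∈ DCProxNewton.convexSubdifferential h₂ x,
      ∀ v ∈ DCProxNewton.convexSubdifferential h₂ y, ‖u - v‖ ≤ Lh₂ * ‖x - y‖)
    (α : ℝ) (hα : α ∈ Set.Ioo (0 : ℝ) (1 / 2))
    (R : DCProxNewton.Run d) (hR : R.IsDCProxNewton f₁ f₂ h₁ h₂ α)
    (m M : ℝ) (hm : 0 < m)
    (hHm : ∀ k, (R.H k - m • (1 : Matrix (Fin d) (Fin d) ℝ)).PosSemidef)
    (hHM : ∀ k, (M • (1 : Matrix (Fin d) (Fin d) ℝ) - R.H k).PosSemidef)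
    (hmaj : ∀ k z, f₁ z ≤ f₁ (R.x k) + inner ℝ (gradient f₁ (R.x k)) (z - R.x k)
      + 1 / 2 * DCProxNewton.sqNorm (R.H k) (z - R.x k))
    (α' : ℝ) (hα' : α' ∈ Set.Ioc (0 : ℝ) 1)
    (hconv : ∀ k, DCProxNewton.objective f₁ f₂ h₁ h₂ (R.x (k + 1))
      ≤ (1 - α') * DCProxNewton.objective f₁ f₂ h₁ h₂ (R.x k)
        + α' * DCProxNewton.objective f₁ f₂ h₁ h₂ (R.x k + R.Δ k)) :
    ∃ p : DCProxNewton.Euc d, Tendsto R.x atTop (𝓝 p) ∧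
      DCProxNewton.IsStationaryPoint f₁ f₂ h₁ h₂ p ∧
      (0 : DCProxNewton.Euc d) ∈
        DCProxNewton.limitingSubdifferential (DCProxNewton.objective f₁ f₂ h₁ h₂) p := by
  open DCProxNewton in
  have hFc := continuous_objective hf hh
  have hFb := bddBelow_range_objective hf hh
  have hsub := R.exists_subgradient_norm_le hf hf₂ hh hh₂ hR hHM
  have hz : ∀ k, objective f₁ f₂ h₁ h₂ (R.x k + R.Δ k)
      ≤ objective f₁ f₂ h₁ h₂ (R.x k) - m / 2 * ‖R.Δ k‖ ^ 2 := fun k => by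
    have h1 := R.objective_add_direction_le hf hh hR hmaj k
    have h2 := mul_norm_sq_le_sqNorm (hHm k) (R.Δ k)
    linarith
  set F := objective f₁ f₂ h₁ h₂
  have hα0 := hα'.1
  set c := α' * (m / 2) with hc_def
  have hc : 0 < c := by positivity
  have hdec : ∀ k, c * ‖R.Δ k‖ ^ 2 ≤ F (R.x k) - F (R.x (k + 1)) := fun k => by
    have := mul_le_mul_of_nonneg_left (hz k) hα0.le
    rw [hc_def]
    linarith [hconv k]
  have hanti : Antitone fun k => F (R.x k) := antitone_nat_of_succ_le fun k => by
    linarith [hdec k, mul_nonneg hc.le (sq_nonneg ‖R.Δ k‖)]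
  have hbdd : BddBelow (Set.range fun k => F (R.x k)) :=
    hFb.mono (Set.range_comp_subset_range R.x F)
  obtain ⟨ℓ, hℓ⟩ : ∃ ℓ, Tendsto (fun k => F (R.x k)) atTop (𝓝 ℓ) :=
    ⟨_, tendsto_atTop_ciInf hanti hbdd⟩
  have hℓle : ∀ k, ℓ ≤ F (R.x k) := fun k => hanti.le_of_tendsto hℓ k
  have hδ0 : Tendsto (fun k => ‖R.Δ k‖) atTop (𝓝 0) := by
    have h1 : Tendsto (fun k => (F (R.x k) - F (R.x (k + 1))) / c) atTop (𝓝 0) := by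
      simpa using (hℓ.sub (hℓ.comp (tendsto_add_atTop_nat 1))).div_const c
    have h2 : Tendsto (fun k => ‖R.Δ k‖ ^ 2) atTop (𝓝 0) :=
      squeeze_zero (fun _ => sq_nonneg _) (fun k => by
        rw [le_div_iff₀ hc]
        linarith [hdec k]) h1
    simpa using h2.sqrt
  have hΔ0 : Tendsto R.Δ atTop (𝓝 0) := tendsto_zero_iff_norm_tendsto_zero.2 hδ0
  obtain ⟨p, -, ψ, hψ, hψp⟩ := tendsto_subseq_of_bounded
    (hcoercive.isBounded_sublevel (F (R.x 0))) (x := R.x) fun k => hanti (Nat.zero_le k)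
  have hFp : F p = ℓ :=
    tendsto_nhds_unique ((hFc.tendsto p).comp hψp) (hℓ.comp hψ.tendsto_atTop)
  have hcluster : MapClusterPt p atTop R.x :=
    MapClusterPt.of_comp hψ.tendsto_atTop hψp.mapClusterPt
  obtain ⟨ρ, hρ, C, hC, hw⟩ := hsub p
  -- Criticality of the cluster point comes first: the KL property is assumed only where the
  -- limiting subdifferential is nonempty. The witnesses are the small subgradients at the full
  -- steps.
  have hcrit : (0 : Euc d) ∈ limitingSubdifferential F p := by
    have hnear : ∀ᶠ j in atTop, dist (R.x (ψ j)) p + ‖R.Δ (ψ j)‖ < ρ := by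
      have : Tendsto (fun j => dist (R.x (ψ j)) p + ‖R.Δ (ψ j)‖) atTop (𝓝 0) := by
        simpa using (tendsto_iff_dist_tendsto_zero.1 hψp).add (hδ0.comp hψ.tendsto_atTop)
      exact this.eventually_lt_const hρ
    obtain ⟨N, hN⟩ := eventually_atTop.1 hnear
    -- The shift by `N` makes the subgradient bound available for every index.
    choose w hwF hwn using fun j => hw (ψ (j + N)) (hN (j + N) (Nat.le_add_left N j))
    have hψ' : Tendsto (fun j => ψ (j + N)) atTop atTop :=
      hψ.tendsto_atTop.comp (tendsto_add_atTop_nat N)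
    have hzp : Tendsto (fun j => R.x (ψ (j + N)) + R.Δ (ψ (j + N))) atTop (𝓝 p) := by
      simpa using (hψp.comp (tendsto_add_atTop_nat N)).add (hΔ0.comp hψ')
    refine ⟨_, w, hzp, (hFc.tendsto p).comp hzp, hwF, ?_⟩
    rw [tendsto_zero_iff_norm_tendsto_zero]
    exact squeeze_zero (fun _ => norm_nonneg _) hwn (by simpa using (hδ0.comp hψ').const_mul C)
  obtain ⟨η, hη, φ, hφ, U, hU, hineq⟩ := hKL p ⟨0, hcrit⟩
  obtain ⟨ρ', hρ', hρU⟩ := Metric.mem_nhds_iff.1 hU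
  have hr0 : Tendsto (fun k => F (R.x k) - ℓ) atTop (𝓝 0) := by
    simpa using hℓ.sub_const ℓ
  have hrη : ∀ᶠ k in atTop, F (R.x k) - ℓ < η := hr0.eventually_lt_const hη
  -- Continuity of `φ` at `0` is only from the right, so the levels must be shown to stay in
  -- `Set.Ico 0 η`.
  have hφ0 : Tendsto (fun k => φ ((F (R.x (k + 1)) - ℓ) / 2)) atTop (𝓝 0) := by
    have h1 : Tendsto (fun k => (F (R.x (k + 1)) - ℓ) / 2) atTop (𝓝[Set.Ico 0 η] 0) := by
      refine tendsto_nhdsWithin_iff.2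
        ⟨by simpa using (hr0.comp (tendsto_add_atTop_nat 1)).div_const 2, ?_⟩
      filter_upwards [(tendsto_add_atTop_nat 1).eventually hrη] with k hk
      exact ⟨by linarith [hℓle (k + 1)], by linarith [hℓle (k + 1)]⟩
    have h2 := (hφ.continuousOn 0 ⟨le_rfl, hη⟩).tendsto.comp h1
    rwa [hφ.map_zero] at h2
  have hx : Tendsto R.x atTop (𝓝 p) := by
    refine tendsto_of_step_le (δ := fun k => ‖R.Δ k‖) (θ := fun k =>
      C / c * φ ((F (R.x (k + 1)) - ℓ) / 2) + 4 / α' / √c * √(F (R.x k) - ℓ))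
      (lt_min hρ hρ') (fun _ => norm_nonneg _) ?_ hδ0 ?_ (R.dist_succ_le hR) hcluster ?_
    · filter_upwards [(tendsto_add_atTop_nat 1).eventually hrη] with k hk
      have h1 := hφ.monotoneOn ⟨le_rfl, hη⟩
        (b := (F (R.x (k + 1)) - ℓ) / 2)
        ⟨by linarith [hℓle (k + 1)], by linarith [hℓle (k + 1)]⟩ (by linarith [hℓle (k + 1)])
      rw [hφ.map_zero] at h1
      positivity
    · simpa using (hφ0.const_mul (C / c)).add (hr0.sqrt.const_mul (4 / α' / √c))
    · filter_upwards [hrη] with k hk hnear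
      obtain ⟨w, hwF, hwn⟩ := hw k (hnear.trans_le (min_le_left _ _))
      have hzU : R.x k + R.Δ k ∈ U := hρU (by
        rw [Metric.mem_ball]
        refine (dist_triangle _ (R.x k) _).trans_lt ?_
        rw [dist_eq_norm (R.x k + R.Δ k), add_sub_cancel_left, add_comm]
        exact hnear.trans_le (min_le_right _ _))
      have hsq : 0 ≤ m / 2 * ‖R.Δ k‖ ^ 2 := by positivity
      have hs : F (R.x k + R.Δ k) - ℓ ≤ F (R.x k) - ℓ := by linarith [hz k]
      have hstep := hφ.step_le (r₀ := F (R.x k) - ℓ) (r₁ := F (R.x (k + 1)) - ℓ)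
        (r₂ := F (R.x (k + 1 + 1)) - ℓ) (s := F (R.x k + R.Δ k) - ℓ) (δ₀ := ‖R.Δ k‖)
        (δ₁ := ‖R.Δ (k + 1)‖) hα' hc hC (by linarith [hℓle (k + 1 + 1)])
        (by linarith [hanti (Nat.le_succ k)]) hk hs (by linarith [hconv k]) (norm_nonneg _)
        (by linarith [hdec (k + 1)]) fun hpos => by
          -- KL at the full step, whose value is below `ℓ + η` because it does not exceed `F (R.x
          -- k)`.
          have h1 := hineq _ hzU (by linarith) (by linarith) w
            (mem_limitingSubdifferential_of_mem_frechetSubdifferential hwF)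
          rw [hFp] at h1
          have h2 := hφ.deriv_pos _ ⟨hpos, hs.trans_lt hk⟩
          exact h1.trans (mul_le_mul_of_nonneg_left hwn h2.le)
      linarith
  exact ⟨p, hx, R.isStationaryPoint_of_tendsto hf hf₂ hh hh₂ hR hHM hx hΔ0, hcrit⟩
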